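/- Let $q\in(-1,1)\setminus\{0\}$. For elements $a,c$ of a unital $*$-algebra over $\mathbb C$ consider the relations $$a^*a+c^*c=1,\qquad aa^*+q^2c^*c=1,\qquad ac=q\,ca,\qquad c^*c=cc^*.\tag{R}$$ Let $\{e_{n,k}\}_{n\in\mathbb Z_+,\,k\in\mathbb Z}$ (where $\mathbb Z_+=\{0,1,2,\dots\}$) be the standard orthonormal basis of $\mathcal H=\ell^2(\mathbb Z_+\times\mathbb Z)$, let $\boldsymbol\alpha,\boldsymbol\gamma$ be the bounded operators on $\mathcal H$ with $$\boldsymbol\alpha e_{n,k}=\sqrt{1-q^{2n}}\,e_{n-1,k}\ \ (\boldsymbol\alpha e_{0,k}=0),\qquad \boldsymbol\gamma e_{n,k}=q^n e_{n,k+1},$$ and let $C^*(\boldsymbol\alpha,\boldsymbol\gamma)\subset B(\mathcal H)$ be the smallest $C^*$-algebra of operators on $\mathcal H$ containing $\boldsymbol\alpha$ and $\boldsymbol\gamma$. Let $\mathcal A$ be the universal $C^*$-algebra generated by two elements $\alpha,\gamma$ subject to (R), i.e. the completion of the unital $*$-algebra generated by symbols $\alpha,\gamma$ subject to (R) in the norm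 $\|x\|=\sup_\varrho\|\varrho(x)\|$ (after dividing by the elements on which it vanishes), $\varrho$ running through the $*$-representations of that algebra on Hilbert spaces. Then: 1. For every complex Hilbert space $\mathcal H_0$ and every pair $(\alpha_0,\gamma_0)$ of bounded operators on $\mathcal H_0$ satisfying (R) there is a unique unital $*$-homomorphism $\varrho\colon C^*(\boldsymbol\alpha,\boldsymbol\gamma)\to B(\mathcal H_0)$ with $\varrho(\boldsymbol\alpha)=\alpha_0$ and $\varrho(\boldsymbol\gamma)=\gamma_0$. 2. The generators $\alpha,\gamma$ of $\mathcal A$ satisfy (R), and for every complex Hilbert space $\mathcal H_0$ and every pair $(\alpha_0,\gamma_0)$ of bounded operators on $\mathcal H_0$ satisfying (R) there is a unique unital $*$-homomorphism $\mathcal A\to B(\mathcal H_0)$ sending $\alpha$ to $\alpha_0$ and $\gamma$ to $\gamma_0$. In particular there is a unique unital $*$-homomorphism $\pi\colon\mathcal A\to B(\mathcal H)$ with $\pi(\alpha)=\boldsymbol\alpha$ and $\pi(\gamma)=\boldsymbol\gamma$ (Woronowicz's representation). 3. The representation $\pi$ is faithful (injective) and its image is $C^*(\boldsymbol\alpha,\boldsymbol\gamma)$;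 hence there is a $*$-isomorphism $\mathcal A\cong C^*(\boldsymbol\alpha,\boldsymbol\gamma)$ sending $\alpha$ to $\boldsymbol\alpha$ and $\gamma$ to $\boldsymbol\gamma$. -/

import Mathlib

open scoped ENNReal

noncomputable section

/-- The defining relations of quantum `SU(2)` for a pair `(a, c)` of elements of a unital
complex `*`-algebra. -/
structure SUq2Rel (q : ℝ) {A : Type*} [Ring A] [StarRing A] [Algebra ℂ A] (a c : A) : Prop where
  star_mul_add : star a * a + star c * c = 1
  mul_star_add : a * star a + ((q : ℂ) ^ 2) • (star c * c) = 1
  mul_comm_q : a * c = (q : ℂ) • (c * a)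
  normal : star c * c = c * star c

/-- The unital C*-algebra of operators generated by the set `S`: the smallest norm-closed unital
`*`-subalgebra containing `S`. -/
def cstarGen {A : Type*} [NormedRing A] [NormedAlgebra ℂ A] [StarRing A] [StarModule ℂ A]
    [ContinuousStar A] (S : Set A) : StarSubalgebra ℂ A :=
  (StarAlgebra.adjoin ℂ S).topologicalClosure

theorem subset_cstarGen {A : Type*} [NormedRing A] [NormedAlgebra ℂ A] [StarRing A]
    [StarModule ℂ A] [ContinuousStar A] (S : Set A) : S ⊆ cstarGen S :=
  (StarAlgebra.subset_adjoin ℂ S).trans (StarSubalgebra.le_topologicalClosure _)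

instance isClosed_cstarGen {A : Type*} [NormedRing A] [NormedAlgebra ℂ A] [StarRing A]
    [StarModule ℂ A] [ContinuousStar A] (S : Set A) : IsClosed (cstarGen S : Set A) :=
  StarSubalgebra.isClosed_topologicalClosure _

/-! ### Woronowicz's operators on `ℓ²(ℤ₊ × ℤ)` -/

/-- The Hilbert space `ℓ²(ℤ₊ × ℤ)`. -/
abbrev SUq2H : Type := lp (fun _ : ℕ × ℤ => ℂ) 2

/-- The standard orthonormal basis `e_{n,k}` of `ℓ²(ℤ₊ × ℤ)`. -/
def SUq2H.e (n : ℕ) (k : ℤ) : SUq2H := lp.single 2 (n, k) (1 : ℂ)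

theorem SUq2H.weighted_aux (φ : ℕ × ℤ → ℕ × ℤ) (hφ : Function.Injective φ) (w : ℕ × ℤ → ℝ)
    (hw : ∀ i, |w i| ≤ 1) (f : SUq2H) :
    Summable (fun i => ‖(w i : ℂ) * f (φ i)‖ ^ (2 : ℝ≥0∞).toReal) ∧
      ∑' i, ‖(w i : ℂ) * f (φ i)‖ ^ (2 : ℝ≥0∞).toReal ≤ ‖f‖ ^ (2 : ℝ≥0∞).toReal := by
  have h2 : 0 < (2 : ℝ≥0∞).toReal := by norm_num
  have hs := (lp.memℓp f).summable h2
  have hs' : Summable (fun i => ‖f (φ i)‖ ^ (2 : ℝ≥0∞).toReal) := hs.comp_injective hφ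
  have hle : ∀ i, ‖(w i : ℂ) * f (φ i)‖ ^ (2 : ℝ≥0∞).toReal
      ≤ ‖f (φ i)‖ ^ (2 : ℝ≥0∞).toReal := by
    intro i
    refine Real.rpow_le_rpow (norm_nonneg _) ?_ h2.le
    rw [norm_mul, Complex.norm_real, Real.norm_eq_abs]
    exact mul_le_of_le_one_left (norm_nonneg _) (hw i)
  have hS := Summable.of_nonneg_of_le (fun i => Real.rpow_nonneg (norm_nonneg _) _) hle hs'
  refine ⟨hS, (hS.tsum_le_tsum hle hs').trans ?_⟩
  rw [lp.norm_rpow_eq_tsum h2]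
  exact hs'.tsum_le_tsum_of_inj φ hφ (fun i _ => Real.rpow_nonneg (norm_nonneg _) _)
    (fun i => le_rfl) hs

/-- The bounded operator `(T f)(i) = w(i) f(φ(i))` on `ℓ²(ℤ₊ × ℤ)`, for `φ` injective and
`|w| ≤ 1`. -/
def SUq2H.weighted (φ : ℕ × ℤ → ℕ × ℤ) (hφ : Function.Injective φ) (w : ℕ × ℤ → ℝ)
    (hw : ∀ i, |w i| ≤ 1) : SUq2H →L[ℂ] SUq2H :=
  LinearMap.mkContinuous
    { toFun := fun f => ⟨fun i => (w i : ℂ) * f (φ i),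
        memℓp_gen (SUq2H.weighted_aux φ hφ w hw f).1⟩
      map_add' := fun f g => by
        ext i
        change (w i : ℂ) * (f (φ i) + g (φ i)) = (w i : ℂ) * f (φ i) + (w i : ℂ) * g (φ i)
        ring
      map_smul' := fun z f => by
        ext i
        change (w i : ℂ) * (z * f (φ i)) = z * ((w i : ℂ) * f (φ i))
        ring }
    1 (fun f => by
      rw [one_mul]
      exact lp.norm_le_of_tsum_le (by norm_num) (norm_nonneg _)
        (SUq2H.weighted_aux φ hφ w hw f).2)

theorem SUq2H.weighted_apply (φ : ℕ × ℤ → ℕ × ℤ) (hφ : Function.Injective φ) (w : ℕ × ℤ → ℝ)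
    (hw : ∀ i, |w i| ≤ 1) (f : SUq2H) (i : ℕ × ℤ) :
    SUq2H.weighted φ hφ w hw f i = (w i : ℂ) * f (φ i) := rfl

/-- Woronowicz's operator `α`, given by `(α f)(n, k) = √(1 - q^{2(n+1)}) f(n + 1, k)`; on the basis
it acts by `α e_{n,k} = √(1 - q^{2n}) e_{n-1,k}` (see `bigAlpha_e_succ`, `bigAlpha_e_zero`). -/
def bigAlpha (q : ℝ) : SUq2H →L[ℂ] SUq2H :=
  SUq2H.weighted (fun i => (i.1 + 1, i.2))
    (fun i j h => by
      simp only [Prod.mk.injEq, add_left_inj] at h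
      exact Prod.ext h.1 h.2)
    (fun i => √(1 - q ^ (2 * (i.1 + 1))))
    (fun i => by
      rw [abs_of_nonneg (Real.sqrt_nonneg _), Real.sqrt_le_one]
      have : 0 ≤ q ^ (2 * (i.1 + 1)) := by
        rw [pow_mul]
        positivity
      linarith)

/-- Woronowicz's operator `γ`, given by `(γ f)(n, k) = q^n f(n, k - 1)`; on the basis
it acts by `γ e_{n,k} = q^n e_{n,k+1}` (see `bigGamma_e`). -/
def bigGamma (q : ℝ) (hq : |q| < 1) : SUq2H →L[ℂ] SUq2H :=
  SUq2H.weighted (fun i => (i.1, i.2 - 1))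
    (fun i j h => by
      simp only [Prod.mk.injEq, sub_left_inj] at h
      exact Prod.ext h.1 h.2)
    (fun i => q ^ i.1)
    (fun i => by
      rw [abs_pow]
      exact pow_le_one₀ (abs_nonneg q) hq.le)

theorem bigAlpha_apply (q : ℝ) (f : SUq2H) (n : ℕ) (k : ℤ) :
    bigAlpha q f (n, k) = ((√(1 - q ^ (2 * (n + 1))) : ℝ) : ℂ) * f (n + 1, k) := rfl

theorem bigGamma_apply (q : ℝ) (hq : |q| < 1) (f : SUq2H) (n : ℕ) (k : ℤ) :
    bigGamma q hq f (n, k) = ((q ^ n : ℝ) : ℂ) * f (n, k - 1) := rfl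

theorem SUq2H.e_apply (n m : ℕ) (k l : ℤ) :
    SUq2H.e n k (m, l) = if m = n ∧ l = k then 1 else 0 := by
  simp [SUq2H.e, lp.single_apply, Pi.single_apply]

theorem SUq2H.smul_apply' (z : ℂ) (f : SUq2H) (i : ℕ × ℤ) : (z • f) i = z * f i := rfl

theorem bigAlpha_e_succ (q : ℝ) (n : ℕ) (k : ℤ) :
    bigAlpha q (SUq2H.e (n + 1) k) = ((√(1 - q ^ (2 * (n + 1))) : ℝ) : ℂ) • SUq2H.e n k := by
  ext ⟨m, l⟩
  refine (bigAlpha_apply q _ m l).trans (Eq.trans ?_ (SUq2H.smul_apply' _ _ (m, l)).symm)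
  rw [SUq2H.e_apply, SUq2H.e_apply]
  by_cases h : m = n ∧ l = k
  · simp [h.1, h.2]
  · simp [h]

theorem bigAlpha_e_zero (q : ℝ) (k : ℤ) : bigAlpha q (SUq2H.e 0 k) = 0 := by
  ext ⟨m, l⟩
  refine (bigAlpha_apply q _ m l).trans ?_
  rw [SUq2H.e_apply]
  simp

theorem bigGamma_e (q : ℝ) (hq : |q| < 1) (n : ℕ) (k : ℤ) :
    bigGamma q hq (SUq2H.e n k) = ((q : ℂ) ^ n) • SUq2H.e n (k + 1) := by
  ext ⟨m, l⟩
  refine (bigGamma_apply q hq _ m l).trans (Eq.trans ?_ (SUq2H.smul_apply' _ _ (m, l)).symm)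
  rw [SUq2H.e_apply, SUq2H.e_apply]
  by_cases h : m = n ∧ l = k + 1
  · simp [h.1, h.2]
  · have h' : ¬ (m = n ∧ l - 1 = k) := by
      rwa [sub_eq_iff_eq_add]
    simp [h, h']

/-- The C*-algebra `C*(α, γ)` of operators on `ℓ²(ℤ₊ × ℤ)`. (Since `α*α + γ*γ = 1`, every
C*-algebra of operators containing `α` and `γ` contains the identity.) -/
def SUq2Conc (q : ℝ) (hq : |q| < 1) : StarSubalgebra ℂ (SUq2H →L[ℂ] SUq2H) :=
  cstarGen {bigAlpha q, bigGamma q hq}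

/-- `α` as an element of `C*(α, γ)`. -/
def SUq2Conc.alpha (q : ℝ) (hq : |q| < 1) : SUq2Conc q hq :=
  ⟨bigAlpha q, subset_cstarGen _ (by simp)⟩

/-- `γ` as an element of `C*(α, γ)`. -/
def SUq2Conc.gamma (q : ℝ) (hq : |q| < 1) : SUq2Conc q hq :=
  ⟨bigGamma q hq, subset_cstarGen _ (by simp)⟩

/-! ### The universal C*-algebra -/

/-- A representation of the defining relations on a (nonzero, complex) Hilbert space. These are the
same thing as the unital `*`-representations on Hilbert spaces of the unital `*`-algebra generated
by two symbols subject to the relations. -/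
structure SUq2Rep (q : ℝ) : Type 1 where
  H : Type
  [grp : NormedAddCommGroup H]
  [inner : InnerProductSpace ℂ H]
  [complete : CompleteSpace H]
  [nontriv : Nontrivial H]
  a : H →L[ℂ] H
  c : H →L[ℂ] H
  rel : SUq2Rel q a c

attribute [instance] SUq2Rep.grp SUq2Rep.inner SUq2Rep.complete SUq2Rep.nontriv

theorem SUq2Rel.norm_le {q : ℝ} {H : Type*} [NormedAddCommGroup H] [InnerProductSpace ℂ H]
    [CompleteSpace H] {a c : H →L[ℂ] H} (h : SUq2Rel q a c) : ‖a‖ ≤ 1 ∧ ‖c‖ ≤ 1 := by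
  have key : ∀ x : H, ‖a x‖ ^ 2 + ‖c x‖ ^ 2 = ‖x‖ ^ 2 := by
    intro x
    have h1 := congrArg (fun T : H →L[ℂ] H => (inner ℂ (T x) x : ℂ)) h.star_mul_add
    simp only [_root_.add_apply, mul_apply_eq_comp,
      ContinuousLinearMap.star_eq_adjoint, inner_add_left,
      ContinuousLinearMap.adjoint_inner_left, one_apply_eq_self,
      inner_self_eq_norm_sq_to_K] at h1
    exact_mod_cast h1
  constructor <;> refine ContinuousLinearMap.opNorm_le_bound _ zero_le_one (fun x => ?_) <;>
    rw [one_mul] <;> refine le_of_sq_le_sq ?_ (norm_nonneg _) <;>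
    nlinarith [key x, sq_nonneg ‖a x‖, sq_nonneg ‖c x‖]

/-- The C*-algebra of all uniformly bounded families `(T_ρ)_ρ` of operators, `T_ρ` acting on the
Hilbert space of `ρ`, with the supremum norm; `ρ` runs through all representations. -/
abbrev SUq2Prod (q : ℝ) : Type 1 := lp (fun ρ : SUq2Rep q => (ρ.H →L[ℂ] ρ.H)) ∞

/-- The family `(ρ(α))_ρ`. -/
def SUq2Prod.alpha (q : ℝ) : SUq2Prod q :=
  ⟨fun ρ => ρ.a, memℓp_infty ⟨1, by rintro _ ⟨ρ, rfl⟩; exact ρ.rel.norm_le.1⟩⟩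

/-- The family `(ρ(γ))_ρ`. -/
def SUq2Prod.gamma (q : ℝ) : SUq2Prod q :=
  ⟨fun ρ => ρ.c, memℓp_infty ⟨1, by rintro _ ⟨ρ, rfl⟩; exact ρ.rel.norm_le.2⟩⟩

/-- The universal C*-algebra generated by `α` and `γ` subject to the defining relations: the
completion of the unital `*`-algebra generated by `α, γ` subject to the relations, in the norm
`‖x‖ = sup_ρ ‖ρ(x)‖`, where `ρ` runs through all representations on Hilbert spaces. The
completion is realised as the closure of the image of that `*`-algebra under `x ↦ (ρ(x))_ρ`. -/
def SUq2Univ (q : ℝ) : StarSubalgebra ℂ (SUq2Prod q) :=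
  cstarGen {SUq2Prod.alpha q, SUq2Prod.gamma q}

/-- The generator `α` of the universal C*-algebra. -/
def SUq2Univ.alpha (q : ℝ) : SUq2Univ q :=
  ⟨SUq2Prod.alpha q, subset_cstarGen _ (by simp)⟩

/-- The generator `γ` of the universal C*-algebra. -/
def SUq2Univ.gamma (q : ℝ) : SUq2Univ q :=
  ⟨SUq2Prod.gamma q, subset_cstarGen _ (by simp)⟩

end

/-!
The argument is the gauge-invariant uniqueness argument. Let `a`, `c` be operators on a Hilbert space
`H` satisfying the relations. For `(s, t)` in the two-dimensional torus `(e^{2πis} a, e^{2πit} c)`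
satisfies them too, so that the two gauge orbits are a pair satisfying the relations in the
C*-algebra `C(𝕋², B(H))` (`SUq2Rel.gaugeOrbit`). Consider the C*-algebra `X` generated, inside
`C(𝕋², B(H)) × B(ℓ²(ℤ₊ × ℤ))`, by the pairs `(orbit of a, α)` and `(orbit of c, γ)`. Everything rests
on the injectivity of the second projection on `X` (`eq_zero_of_snd_eq_zero`): this projection is then
isometric and identifies `X` with `C*(α, γ)`, and evaluation of the first component at the neutral
element of the torus is the required representation (`SUq2Conc.exists_hom`).

For the injectivity, average the first component over the torus, and take the diagonal coefficients
of the second one at the vectors `e_{n,0}`. The relations imply `a c* = q c* a`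
(`SUq2Rel.mul_star_comm_q`), so the ordered monomials `aⁱ cʲ c*ᵏ` and `a*ⁱ cʲ c*ᵏ` span the
`*`-algebra generated by `a` and `c` (`SUq2Rel.adjoin_le_span`). The average and the diagonal kill
those of nonzero bidegree, and so send a noncommutative polynomial in the generators of `X` to
`p(c* c)` and to the sequence `p(q^{2n})` with the same one-variable polynomial `p`. Because
`a* a = 1 - c* c` and `a a* = 1 - q² c* c` have the same nonzero spectrum, the spectrum of `c* c` is
contained in `{q^{2n}} ∪ {0}` (`SUq2Rel.spectrum_subset`). Therefore `‖p(c* c)‖ ≤ sup_n |p(q^{2n})|`,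
and on all of `X` the norm of the average is at most the norm of the second component
(`norm_integral_fst_le`). If `(f, 0)` lies in `X`, the average of `f* f` is thus zero, and `f = 0`
because averaging is faithful.

The universal C*-algebra is treated through its definition as a C*-algebra of families of operators:
every one of its representations factors through the component `π` on `ℓ²(ℤ₊ × ℤ)`
(`SUq2Univ.exists_factor`), so that an element of the kernel of `π` has all components zero.
-/

noncomputable section

/-! ### Consequences of the relations in a C*-algebra -/

namespace SUq2Rel

section CStar

variable {q : ℝ} {A : Type*} [CStarAlgebra A] {a c : A}

/-- In a C*-algebra the defining relations force `a` to commute up to the scalar `q` with `c*`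
as well. With `x = a c* - q c* a`, the relations give `c x = x c = 0`, so that `x x* x = 0`, and the
C*-identity makes `x` vanish. -/
theorem mul_star_comm_q (h : SUq2Rel q a c) (hq0 : q ≠ 0) :
    a * star c = (q : ℂ) • (star c * a) := by
  have hqc : (q : ℂ) ≠ 0 := by exact_mod_cast hq0
  obtain ⟨h1, h2, h3, h4⟩ := h
  set x := a * star c - (q : ℂ) • (star c * a) with hx
  -- associativity gives `a (c* c) = q² (c* c) a`
  have h5 : a * (star c * c) = ((q : ℂ) ^ 2) • (star c * c * a) := by
    have e1 : star c * c = 1 - star a * a := eq_sub_of_add_eq' h1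
    have e2 : a * star a = 1 - ((q : ℂ) ^ 2) • (star c * c) := eq_sub_of_add_eq h2
    calc a * (star c * c) = a - a * star a * a := by rw [e1]; noncomm_ring
      _ = ((q : ℂ) ^ 2) • (star c * c * a) := by rw [e2, sub_mul, smul_mul_assoc]; simp
  have hcx : c * x = 0 := by
    have e : (q : ℂ) • (c * x) = 0 := by
      calc (q : ℂ) • (c * x)
          = (q : ℂ) • (c * a) * star c - ((q : ℂ) ^ 2) • (c * star c * a) := by
            rw [hx, mul_sub, smul_sub, mul_smul_comm, smul_smul, pow_two, smul_mul_assoc,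
              mul_assoc, mul_assoc]
        _ = a * (star c * c) - ((q : ℂ) ^ 2) • (star c * c * a) := by
            rw [← h3, ← h4, mul_assoc, ← h4]
        _ = 0 := by rw [h5, sub_self]
    exact (smul_eq_zero.1 e).resolve_left hqc
  have hxc : x * c = 0 := by
    calc x * c = a * (star c * c) - (q : ℂ) • (star c * (a * c)) := by
          rw [hx, sub_mul, smul_mul_assoc, mul_assoc, mul_assoc]
      _ = 0 := by rw [h5, h3, mul_smul_comm, smul_smul, pow_two, mul_assoc, sub_self]
  have hsx : star x = c * star a - (q : ℂ) • (star a * c) := by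
    simp [hx, star_smul]
  have h6 : x * star x * x = 0 := by
    have : x * star x = x * c * star a - (q : ℂ) • (x * star a * c) := by
      rw [hsx, mul_sub, mul_smul_comm, mul_assoc, mul_assoc]
    rw [this, hxc, sub_mul, smul_mul_assoc, mul_assoc _ c x, hcx]
    simp
  have h7 : star x * x = 0 := by
    rw [← CStarRing.star_mul_self_eq_zero_iff, star_mul, star_star, mul_assoc, ← mul_assoc x,
      h6, mul_zero]
  rw [CStarRing.star_mul_self_eq_zero_iff] at h7
  exact sub_eq_zero.1 h7

theorem c_mul_a (h : SUq2Rel q a c) (hq0 : q ≠ 0) : c * a = (q : ℂ)⁻¹ • (a * c) := by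
  rw [h.mul_comm_q, smul_smul, inv_mul_cancel₀ (by exact_mod_cast hq0), one_smul]

theorem star_c_mul_a (h : SUq2Rel q a c) (hq0 : q ≠ 0) :
    star c * a = (q : ℂ)⁻¹ • (a * star c) := by
  rw [h.mul_star_comm_q hq0, smul_smul, inv_mul_cancel₀ (by exact_mod_cast hq0), one_smul]

theorem c_mul_star_a (h : SUq2Rel q a c) (hq0 : q ≠ 0) : c * star a = (q : ℂ) • (star a * c) := by
  simpa [star_smul] using congrArg star (h.mul_star_comm_q hq0)

theorem star_c_mul_star_a (h : SUq2Rel q a c) : star c * star a = (q : ℂ) • (star a * star c) := by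
  simpa [star_smul] using congrArg star h.mul_comm_q

end CStar

/-! ### Ordered monomials -/

/-- The ordered monomials `aⁱ cʲ c*ᵏ` and `a*ⁱ cʲ c*ᵏ`. -/
def monomials {A : Type*} [Ring A] [StarRing A] (a c : A) : Set A :=
  {x | ∃ i j k : ℕ, x = a ^ i * (c ^ j * star c ^ k) ∨ x = star a ^ i * (c ^ j * star c ^ k)}

theorem mul_pow_of_comm_smul {A : Type*} [Ring A] [Algebra ℂ A] {r : ℂ} {d u : A}
    (h : d * u = r • (u * d)) (i : ℕ) : d * u ^ i = r ^ i • (u ^ i * d) := by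
  induction i with
  | zero => simp
  | succ i ih =>
    rw [pow_succ, ← mul_assoc, ih, smul_mul_assoc, mul_assoc, h, mul_smul_comm, smul_smul,
      ← pow_succ, mul_assoc]

section Span

variable {A : Type*} [Ring A] [StarRing A] [Algebra ℂ A] {a c : A}

theorem mul_c_word (i j k : ℕ) {u : A} {r : ℂ} (hu : c * u = r • (u * c)) :
    c * (u ^ i * (c ^ j * star c ^ k)) = r ^ i • (u ^ i * (c ^ (j + 1) * star c ^ k)) := by
  rw [← mul_assoc, mul_pow_of_comm_smul hu, smul_mul_assoc, mul_assoc, pow_succ', mul_assoc c]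

theorem mul_star_c_word (hn : star c * c = c * star c) (i j k : ℕ) {u : A} {r : ℂ}
    (hu : star c * u = r • (u * star c)) :
    star c * (u ^ i * (c ^ j * star c ^ k)) = r ^ i • (u ^ i * (c ^ j * star c ^ (k + 1))) := by
  have hn' : Commute (star c) (c ^ j) := (show Commute (star c) c from hn).pow_right j
  rw [← mul_assoc, mul_pow_of_comm_smul hu, smul_mul_assoc, mul_assoc, ← mul_assoc (star c),
    hn'.eq, mul_assoc (c ^ j), pow_succ']

theorem mul_cancel_word (hn : star c * c = c * star c) (i j k : ℕ) {u v : A} {r t : ℂ}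
    (hvu : v * u + t • (star c * c) = 1) (hu : c * u = r • (u * c))
    (hu' : star c * u = r • (u * star c)) :
    v * (u ^ (i + 1) * (c ^ j * star c ^ k)) = u ^ i * (c ^ j * star c ^ k) -
      (t * r ^ i * r ^ i) • (u ^ i * (c ^ (j + 1) * star c ^ (k + 1))) := by
  rw [pow_succ', mul_assoc u, ← mul_assoc v, eq_sub_of_add_eq hvu, sub_mul, one_mul,
    smul_mul_assoc, mul_assoc (star c), mul_c_word i j k hu, mul_smul_comm, mul_star_c_word hn _ _ _ hu',
    smul_smul, smul_smul]

theorem word_mem_span (i j k : ℕ) :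
    a ^ i * (c ^ j * star c ^ k) ∈ Submodule.span ℂ (monomials a c) :=
  Submodule.subset_span ⟨i, j, k, Or.inl rfl⟩

theorem star_word_mem_span (i j k : ℕ) :
    star a ^ i * (c ^ j * star c ^ k) ∈ Submodule.span ℂ (monomials a c) :=
  Submodule.subset_span ⟨i, j, k, Or.inr rfl⟩

end Span

/-- The ordered monomials span the `*`-algebra generated by `a` and `c`: their span contains `1` and
is stable under left multiplication by `a`, `a*`, `c`, `c*`. -/
theorem adjoin_le_span {q : ℝ} {A : Type*} [CStarAlgebra A] {a c : A} (h : SUq2Rel q a c)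
    (hq0 : q ≠ 0) {x : A} (hx : x ∈ StarAlgebra.adjoin ℂ {a, c}) :
    x ∈ Submodule.span ℂ (monomials a c) := by
  set V := Submodule.span ℂ (monomials a c)
  have hn := h.normal
  have red : ∀ g : A, (∀ i j k : ℕ, g * (a ^ i * (c ^ j * star c ^ k)) ∈ V) →
      (∀ i j k : ℕ, g * (star a ^ i * (c ^ j * star c ^ k)) ∈ V) → ∀ v ∈ V, g * v ∈ V := by
    intro g hg1 hg2 v hv
    induction hv using Submodule.span_induction with
    | mem y hy =>
      obtain ⟨i, j, k, rfl | rfl⟩ := hy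
      · exact hg1 i j k
      · exact hg2 i j k
    | zero => simp
    | add y z _ _ hy hz => rw [mul_add]; exact add_mem hy hz
    | smul t y _ hy => rw [mul_smul_comm]; exact V.smul_mem t hy
  have hgen : ∀ g ∈ ({a, c} : Set A) ∪ star {a, c}, ∀ v ∈ V, g * v ∈ V := by
    intro g hg
    have hg' : g = a ∨ g = c ∨ g = star a ∨ g = star c := by
      rcases hg with hg | hg
      · rcases hg with rfl | rfl <;> simp
      · rcases Set.mem_star.1 hg with hg | hg
        · exact Or.inr (Or.inr (Or.inl (by rw [← hg, star_star])))
        · exact Or.inr (Or.inr (Or.inr (by rw [← Set.mem_singleton_iff.1 hg, star_star])))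
    refine red g ?_ ?_ <;> intro i j k <;> rcases hg' with rfl | rfl | rfl | rfl
    · rw [← mul_assoc, ← pow_succ']
      exact word_mem_span _ _ _
    · rw [mul_c_word _ _ _ (h.c_mul_a hq0)]
      exact V.smul_mem _ (word_mem_span _ _ _)
    · cases i with
      | zero => simpa using star_word_mem_span (a := a) (c := c) 1 j k
      | succ i =>
        rw [mul_cancel_word hn i j k (t := 1) (by rw [one_smul]; exact h.star_mul_add)
          (h.c_mul_a hq0) (h.star_c_mul_a hq0)]
        exact sub_mem (word_mem_span _ _ _) (V.smul_mem _ (word_mem_span _ _ _))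
    · rw [mul_star_c_word hn _ _ _ (h.star_c_mul_a hq0)]
      exact V.smul_mem _ (word_mem_span _ _ _)
    · cases i with
      | zero => simpa using word_mem_span (a := g) (c := c) 1 j k
      | succ i =>
        rw [mul_cancel_word hn i j k h.mul_star_add (h.c_mul_star_a hq0) h.star_c_mul_star_a]
        exact sub_mem (star_word_mem_span _ _ _) (V.smul_mem _ (star_word_mem_span _ _ _))
    · rw [mul_c_word _ _ _ (h.c_mul_star_a hq0)]
      exact V.smul_mem _ (star_word_mem_span _ _ _)
    · rw [← mul_assoc, ← pow_succ']
      exact star_word_mem_span _ _ _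
    · rw [mul_star_c_word hn _ _ _ h.star_c_mul_star_a]
      exact V.smul_mem _ (star_word_mem_span _ _ _)
  have hall : ∀ v ∈ V, x * v ∈ V := by
    have hx' : x ∈ Algebra.adjoin ℂ (({a, c} : Set A) ∪ star {a, c}) := hx
    induction hx' using Algebra.adjoin_induction with
    | mem g hg => exact hgen g hg
    | algebraMap r =>
      intro v hv
      rw [← Algebra.smul_def]
      exact V.smul_mem r hv
    | add y z hy hz ihy ihz =>
      intro v hv
      rw [add_mul]
      exact add_mem (ihy hy v hv) (ihz hz v hv)
    | mul y z hy hz ihy ihz =>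
      intro v hv
      rw [mul_assoc]
      exact ihy hy _ (ihz hz v hv)
  simpa using hall 1 (by simpa using word_mem_span (a := a) (c := c) 0 0 0)

/-! ### The spectrum of `c* c` -/

section Spectrum

variable {q : ℝ} {A : Type*} [CStarAlgebra A] {a c : A}

open scoped Pointwise in
/-- Since `a* a = 1 - c* c` and `a a* = 1 - q² c* c` have the same nonzero spectrum, every point
`z ≠ 1` of the spectrum of `c* c` has the form `q² w` with `w` in that spectrum. -/
theorem exists_spectrum_of_ne_one (h : SUq2Rel q a c) (hq0 : q ≠ 0) {z : ℂ}
    (hz : z ∈ spectrum ℂ (star c * c)) (hz1 : z ≠ 1) :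
    ∃ w ∈ spectrum ℂ (star c * c), z = (q : ℂ) ^ 2 * w := by
  have hqc : ((q : ℂ) ^ 2) ≠ 0 := pow_ne_zero _ (by exact_mod_cast hq0)
  have e1 : star a * a = algebraMap ℂ A 1 - star c * c := by
    rw [map_one]; exact eq_sub_of_add_eq h.star_mul_add
  have e2 : a * star a = algebraMap ℂ A 1 - ((q : ℂ) ^ 2) • (star c * c) := by
    rw [map_one]; exact eq_sub_of_add_eq h.mul_star_add
  have h1 : 1 - z ∈ spectrum ℂ (star a * a) \ {0} := by
    refine ⟨?_, fun h0 => hz1 (sub_eq_zero.1 h0).symm⟩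
    rw [e1, ← spectrum.singleton_sub_eq]
    exact Set.sub_mem_sub rfl hz
  rw [spectrum.nonzero_mul_comm, e2, ← spectrum.singleton_sub_eq] at h1
  obtain ⟨s, hs, t, ht, hst⟩ := h1.1
  have hst' : s - t = 1 - z := hst
  rw [Set.mem_singleton_iff.1 hs, sub_right_inj] at hst'
  have ht' : t ∈ (Units.mk0 _ hqc) • spectrum ℂ (star c * c) := by
    rw [← spectrum.unit_smul_eq_smul]
    exact ht
  obtain ⟨w, hw, hwt⟩ := ht'
  exact ⟨w, hw, hst'.symm.trans hwt.symm⟩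

theorem spectrum_subset (h : SUq2Rel q a c) (hq : |q| < 1) (hq0 : q ≠ 0) :
    spectrum ℂ (star c * c) ⊆ insert 0 (Set.range fun n : ℕ => ((q : ℂ) ^ 2) ^ n) := by
  intro z hz
  by_contra hz'
  rw [Set.mem_insert_iff, not_or] at hz'
  obtain ⟨hz0, hzr⟩ := hz'
  -- otherwise the division by `q²` never stops and the spectrum is unbounded
  have key : ∀ n : ℕ, ∃ w ∈ spectrum ℂ (star c * c), z = ((q : ℂ) ^ 2) ^ n * w := by
    intro n
    induction n with
    | zero => exact ⟨z, hz, by simp⟩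
    | succ n ih =>
      obtain ⟨w, hw, rfl⟩ := ih
      have hw1 : w ≠ 1 := by
        rintro rfl
        exact hzr ⟨n, by simp⟩
      obtain ⟨v, hv, rfl⟩ := h.exists_spectrum_of_ne_one hq0 hw hw1
      exact ⟨v, hv, by ring⟩
  obtain ⟨R, hR⟩ := (spectrum.isBounded (𝕜 := ℂ) (star c * c)).exists_norm_le
  have hq2 : ‖(q : ℂ) ^ 2‖ < 1 := by
    rw [norm_pow, Complex.norm_real, Real.norm_eq_abs]
    exact pow_lt_one₀ (abs_nonneg q) hq two_ne_zero
  have hlim : Filter.Tendsto (fun n : ℕ => ‖(q : ℂ) ^ 2‖ ^ n * R) Filter.atTop (nhds (0 * R)) :=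
    (tendsto_pow_atTop_nhds_zero_of_lt_one (norm_nonneg _) hq2).mul_const R
  have hle : ‖z‖ ≤ 0 * R := by
    refine ge_of_tendsto' hlim fun n => ?_
    obtain ⟨w, hw, e⟩ := key n
    rw [e, norm_mul, norm_pow]
    exact mul_le_mul_of_nonneg_left (hR w hw) (by positivity)
  rw [zero_mul, norm_le_zero_iff] at hle
  exact hz0 hle

/-- A polynomial in `c* c` is bounded in norm by its values on the powers of `q²`; the value at `0`
is a limit of these. -/
theorem norm_aeval_le (h : SUq2Rel q a c) (hq : |q| < 1) (hq0 : q ≠ 0) (p : Polynomial ℂ) {C : ℝ}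
    (hp : ∀ n : ℕ, ‖p.eval (((q : ℂ) ^ 2) ^ n)‖ ≤ C) :
    ‖Polynomial.aeval (star c * c) p‖ ≤ C := by
  have hsa : IsStarNormal (star c * c) := (IsSelfAdjoint.star_mul_self c).isStarNormal
  rw [← cfc_polynomial p (star c * c) hsa]
  refine norm_cfc_le ((norm_nonneg _).trans (hp 0)) fun z hz => ?_
  rcases h.spectrum_subset hq hq0 hz with rfl | ⟨n, rfl⟩
  · have hq2 : ‖(q : ℂ) ^ 2‖ < 1 := by
      rw [norm_pow, Complex.norm_real, Real.norm_eq_abs]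
      exact pow_lt_one₀ (abs_nonneg q) hq two_ne_zero
    have hlim := (p.continuous.norm.tendsto 0).comp (tendsto_pow_atTop_nhds_zero_of_norm_lt_one hq2)
    exact le_of_tendsto' hlim hp
  · exact hp n

end Spectrum
end SUq2Rel

/-! ### Woronowicz's operators in coordinates -/

namespace SUq2H

theorem star_apply (T : SUq2H →L[ℂ] SUq2H) (f : SUq2H) (n : ℕ) (k : ℤ) :
    (star T) f (n, k) = inner ℂ (T (e n k)) f := by
  have h1 : inner ℂ (e n k) ((star T) f) = (star T) f (n, k) := by
    rw [e, lp.inner_single_left]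
    simp
  rw [← h1, ContinuousLinearMap.star_eq_adjoint, ContinuousLinearMap.adjoint_inner_right]

theorem inner_e (f : SUq2H) (n : ℕ) (k : ℤ) : inner ℂ (e n k) f = f (n, k) := by
  rw [e, lp.inner_single_left]
  simp

end SUq2H

theorem star_bigAlpha_apply_zero (q : ℝ) (f : SUq2H) (k : ℤ) :
    star (bigAlpha q) f (0, k) = 0 := by
  rw [SUq2H.star_apply, bigAlpha_e_zero, inner_zero_left]

theorem star_bigAlpha_apply_succ (q : ℝ) (f : SUq2H) (n : ℕ) (k : ℤ) :
    star (bigAlpha q) f (n + 1, k) = ((√(1 - q ^ (2 * (n + 1))) : ℝ) : ℂ) * f (n, k) := by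
  rw [SUq2H.star_apply, bigAlpha_e_succ, inner_smul_left, SUq2H.inner_e, Complex.conj_ofReal]

theorem star_bigGamma_apply (q : ℝ) (hq : |q| < 1) (f : SUq2H) (n : ℕ) (k : ℤ) :
    star (bigGamma q hq) f (n, k) = ((q ^ n : ℝ) : ℂ) * f (n, k + 1) := by
  rw [SUq2H.star_apply, bigGamma_e, inner_smul_left, SUq2H.inner_e]
  simp

theorem sqrt_mul_sqrt_one_sub (q : ℝ) (hq : |q| < 1) (n : ℕ) :
    ((√(1 - q ^ (2 * n)) : ℝ) : ℂ) * ((√(1 - q ^ (2 * n)) : ℝ) : ℂ) = 1 - (q : ℂ) ^ (2 * n) := by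
  have h : 0 ≤ 1 - q ^ (2 * n) := by
    rw [pow_mul, sub_nonneg]
    exact pow_le_one₀ (sq_nonneg q) ((sq_le_one_iff_abs_le_one q).2 hq.le)
  rw [← Complex.ofReal_mul, Real.mul_self_sqrt h]
  push_cast
  rfl

theorem bigAlpha_bigGamma_rel (q : ℝ) (hq : |q| < 1) : SUq2Rel q (bigAlpha q) (bigGamma q hq) where
  star_mul_add := by
    ext f ⟨n, k⟩
    change star (bigAlpha q) (bigAlpha q f) (n, k) +
      star (bigGamma q hq) (bigGamma q hq f) (n, k) = f (n, k)
    rw [star_bigGamma_apply, bigGamma_apply, add_sub_cancel_right]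
    cases n with
    | zero => simp [star_bigAlpha_apply_zero]
    | succ n =>
      rw [star_bigAlpha_apply_succ, bigAlpha_apply, ← mul_assoc, sqrt_mul_sqrt_one_sub q hq]
      push_cast
      ring
  mul_star_add := by
    ext f ⟨n, k⟩
    change bigAlpha q (star (bigAlpha q) f) (n, k) +
      (q : ℂ) ^ 2 * star (bigGamma q hq) (bigGamma q hq f) (n, k) = f (n, k)
    rw [star_bigGamma_apply, bigGamma_apply, add_sub_cancel_right, bigAlpha_apply,
      star_bigAlpha_apply_succ, ← mul_assoc, sqrt_mul_sqrt_one_sub q hq]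
    push_cast
    ring
  mul_comm_q := by
    ext f ⟨n, k⟩
    change bigAlpha q (bigGamma q hq f) (n, k) = (q : ℂ) * bigGamma q hq (bigAlpha q f) (n, k)
    simp only [bigAlpha_apply, bigGamma_apply]
    push_cast
    ring
  normal := by
    ext f ⟨n, k⟩
    change star (bigGamma q hq) (bigGamma q hq f) (n, k) =
      bigGamma q hq (star (bigGamma q hq) f) (n, k)
    simp only [star_bigGamma_apply, bigGamma_apply, add_sub_cancel_right, sub_add_cancel]

theorem bigGamma_word_e (q : ℝ) (hq : |q| < 1) (j k n : ℕ) :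
    (bigGamma q hq ^ j * star (bigGamma q hq) ^ k) (SUq2H.e n 0) =
      (((q : ℂ) ^ n) ^ (j + k)) • SUq2H.e n (j - k) := by
  have h2 : ∀ l, star (bigGamma q hq) (SUq2H.e n l) = ((q : ℂ) ^ n) • SUq2H.e n (l - 1) := by
    intro l
    ext ⟨m, i⟩
    refine (star_bigGamma_apply q hq _ m i).trans (Eq.trans ?_ (SUq2H.smul_apply' _ _ (m, i)).symm)
    rw [SUq2H.e_apply, SUq2H.e_apply]
    by_cases h : m = n ∧ i + 1 = l
    · simp [h.1, ← h.2]
    · have h' : ¬ (m = n ∧ i = l - 1) := by rwa [eq_sub_iff_add_eq]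
      simp [h, h']
  have h3 : (star (bigGamma q hq) ^ k) (SUq2H.e n 0) = (((q : ℂ) ^ n) ^ k) • SUq2H.e n (-k) := by
    induction k with
    | zero => simp
    | succ k ih =>
      rw [pow_succ', mul_apply_eq_comp, ih, map_smul, h2, smul_smul, ← pow_succ]
      congr 2
      push_cast
      ring
  rw [mul_apply_eq_comp, h3, map_smul]
  induction j with
  | zero => simp
  | succ j ih =>
    rw [pow_succ', mul_apply_eq_comp, ← map_smul, ih, map_smul, bigGamma_e, smul_smul]
    congr 2
    · ring
    · push_cast
      ring

/-- `αⁱ` lowers the first index by `i`. -/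
theorem bigAlpha_pow_apply_eq_zero (q : ℝ) {N : ℕ} {f : SUq2H} (hf : ∀ m, N ≤ m → ∀ l, f (m, l) = 0)
    (i : ℕ) : ∀ m, N ≤ m + i → ∀ l, (bigAlpha q ^ i) f (m, l) = 0 := by
  induction i with
  | zero => simpa using hf
  | succ i ih =>
    intro m hm l
    rw [pow_succ', mul_apply_eq_comp, bigAlpha_apply, ih (m + 1) (by omega), mul_zero]

/-- `α*ⁱ` raises the first index by `i`. -/
theorem star_bigAlpha_pow_apply_eq_zero (q : ℝ) {N : ℕ} {f : SUq2H}
    (hf : ∀ m, m < N → ∀ l, f (m, l) = 0) (i : ℕ) :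
    ∀ m, m < N + i → ∀ l, (star (bigAlpha q) ^ i) f (m, l) = 0 := by
  induction i with
  | zero => simpa using hf
  | succ i ih =>
    intro m hm l
    rw [pow_succ', mul_apply_eq_comp]
    cases m with
    | zero => rw [star_bigAlpha_apply_zero]
    | succ m => rw [star_bigAlpha_apply_succ, ih m (by omega), mul_zero]

theorem diagonal_word (q : ℝ) (hq : |q| < 1) (i j k n : ℕ) :
    (bigAlpha q ^ i * (bigGamma q hq ^ j * star (bigGamma q hq) ^ k)) (SUq2H.e n 0) (n, 0) =
      if i = 0 ∧ j = k then (((q : ℂ) ^ 2) ^ n) ^ j else 0 := by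
  rw [mul_apply_eq_comp, bigGamma_word_e, map_smul, SUq2H.smul_apply']
  rcases Nat.eq_zero_or_pos i with rfl | hi
  · rw [pow_zero, one_apply_eq_self, SUq2H.e_apply]
    by_cases h : j = k
    · subst h
      simp only [sub_self, and_self, if_true, mul_one]
      ring
    · have : ¬ (0 : ℤ) = j - k := by omega
      simp [h, this]
  · rw [bigAlpha_pow_apply_eq_zero q (N := n + 1) _ i n (by omega), mul_zero, if_neg (by omega)]
    intro m hm l
    rw [SUq2H.e_apply, if_neg (by omega)]

theorem diagonal_star_word (q : ℝ) (hq : |q| < 1) (i j k n : ℕ) :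
    (star (bigAlpha q) ^ i * (bigGamma q hq ^ j * star (bigGamma q hq) ^ k)) (SUq2H.e n 0) (n, 0) =
      if i = 0 ∧ j = k then (((q : ℂ) ^ 2) ^ n) ^ j else 0 := by
  rcases Nat.eq_zero_or_pos i with rfl | hi
  · simpa using diagonal_word q hq 0 j k n
  · rw [mul_apply_eq_comp, bigGamma_word_e, map_smul, SUq2H.smul_apply',
      star_bigAlpha_pow_apply_eq_zero q (N := n) _ i n (by omega), mul_zero, if_neg (by omega)]
    intro m hm l
    rw [SUq2H.e_apply, if_neg (by omega)]

theorem norm_diagonal_le (T : SUq2H →L[ℂ] SUq2H) (n : ℕ) (k : ℤ) :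
    ‖T (SUq2H.e n k) (n, k)‖ ≤ ‖T‖ := by
  have h1 : ‖SUq2H.e n k‖ = 1 := by
    rw [SUq2H.e, lp.norm_single (by norm_num)]
    simp
  calc ‖T (SUq2H.e n k) (n, k)‖ ≤ ‖T (SUq2H.e n k)‖ := lp.norm_apply_le_norm (by norm_num) _ _
    _ ≤ ‖T‖ * ‖SUq2H.e n k‖ := T.le_opNorm _
    _ = ‖T‖ := by rw [h1, mul_one]

/-! ### Gauge orbits and averaging over the torus -/

section Gauge

open MeasureTheory

/-- The group of gauge parameters, the two-dimensional torus. -/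
abbrev Torus2 : Type := UnitAddCircle × UnitAddCircle

/-- Normalised Haar measure on the torus. -/
abbrev torusMeasure : Measure Torus2 :=
  (AddCircle.haarAddCircle (T := 1)).prod (AddCircle.haarAddCircle (T := 1))

/-- The function `(s, t) ↦ e^{2πi(ms + nt)} x` on the torus: the orbit of an element `x` of
bidegree `(m, n)` under the gauge action. -/
def gaugeOrbit {B : Type*} [CStarAlgebra B] (m n : ℤ) (x : B) : C(Torus2, B) :=
  ⟨fun t => (fourier m t.1 * fourier n t.2 : ℂ) • x, by fun_prop⟩

variable {B : Type*} [CStarAlgebra B]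

theorem gaugeOrbit_apply (m n : ℤ) (x : B) (t : Torus2) :
    gaugeOrbit m n x t = (fourier m t.1 * fourier n t.2 : ℂ) • x := rfl

theorem gaugeOrbit_mul (m n m' n' : ℤ) (x y : B) :
    gaugeOrbit m n x * gaugeOrbit m' n' y = gaugeOrbit (m + m') (n + n') (x * y) := by
  ext t
  simp only [ContinuousMap.mul_apply, gaugeOrbit_apply, smul_mul_smul_comm, fourier_add]
  congr 1
  ring

theorem star_gaugeOrbit (m n : ℤ) (x : B) :
    star (gaugeOrbit m n x) = gaugeOrbit (-m) (-n) (star x) := by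
  ext t
  simp only [ContinuousMap.star_apply, gaugeOrbit_apply, star_smul, fourier_neg, star_mul',
    RCLike.star_def]

theorem gaugeOrbit_zero_zero_one : gaugeOrbit 0 0 (1 : B) = 1 := by
  ext t
  rw [gaugeOrbit_apply, fourier_zero, fourier_zero, mul_one, one_smul, ContinuousMap.one_apply]

theorem gaugeOrbit_add (m n : ℤ) (x y : B) :
    gaugeOrbit m n x + gaugeOrbit m n y = gaugeOrbit m n (x + y) := by
  ext t
  simp only [ContinuousMap.add_apply, gaugeOrbit_apply, smul_add]

theorem smul_gaugeOrbit (r : ℂ) (m n : ℤ) (x : B) :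
    r • gaugeOrbit m n x = gaugeOrbit m n (r • x) := by
  ext t
  simp only [ContinuousMap.smul_apply, gaugeOrbit_apply]
  rw [smul_comm]

theorem gaugeOrbit_pow (m n : ℤ) (x : B) (i : ℕ) :
    gaugeOrbit m n x ^ i = gaugeOrbit (i * m) (i * n) (x ^ i) := by
  induction i with
  | zero => simp [gaugeOrbit_zero_zero_one]
  | succ i ih =>
    rw [pow_succ, ih, gaugeOrbit_mul, pow_succ]
    congr 1 <;> push_cast <;> ring

/-- The gauge orbits of `a` and `c` satisfy the relations of `a` and `c`, because the relations are
homogeneous for the bidegrees `(1, 0)` of `a` and `(0, 1)` of `c`. -/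
theorem SUq2Rel.gaugeOrbit {q : ℝ} {a c : B} (h : SUq2Rel q a c) :
    SUq2Rel q (gaugeOrbit 1 0 a) (gaugeOrbit 0 1 c) where
  star_mul_add := by
    simp only [star_gaugeOrbit, gaugeOrbit_mul]
    simpa [gaugeOrbit_add, h.star_mul_add] using gaugeOrbit_zero_zero_one
  mul_star_add := by
    simp only [star_gaugeOrbit, gaugeOrbit_mul, smul_gaugeOrbit]
    simpa [gaugeOrbit_add, h.mul_star_add] using gaugeOrbit_zero_zero_one
  mul_comm_q := by
    simp only [gaugeOrbit_mul, smul_gaugeOrbit, h.mul_comm_q]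
    simp
  normal := by
    simp only [star_gaugeOrbit, gaugeOrbit_mul, h.normal]
    simp

theorem integral_fourier_haar (n : ℤ) :
    ∫ t, (fourier n t : ℂ) ∂(AddCircle.haarAddCircle (T := 1)) = if n = 0 then 1 else 0 := by
  split_ifs with h
  · subst h
    simp
  · exact integral_eq_zero_of_add_right_eq_neg (fourier_add_half_inv_index h Fact.out)

theorem integral_gaugeOrbit (m n : ℤ) (x : B) :
    ∫ t, gaugeOrbit m n x t ∂torusMeasure = if m = 0 ∧ n = 0 then x else 0 := by
  simp only [gaugeOrbit_apply]
  rw [integral_smul_const, integral_prod_mul (fun t => (fourier m t : ℂ))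
    (fun t => (fourier n t : ℂ)), integral_fourier_haar, integral_fourier_haar]
  by_cases hm : m = 0 <;> by_cases hn : n = 0 <;> simp [hm, hn]

theorem integrable_torus {E : Type*} [NormedAddCommGroup E] (f : C(Torus2, E)) :
    Integrable f torusMeasure :=
  f.continuous.integrable_of_hasCompactSupport (HasCompactSupport.of_compactSpace f)

theorem continuous_integral_torus :
    Continuous fun f : C(Torus2, B) => ∫ t, f t ∂torusMeasure := by
  refine (LipschitzWith.of_dist_le_mul (K := 1) fun f g => ?_).continuous
  rw [dist_eq_norm, dist_eq_norm, ← integral_sub (integrable_torus f) (integrable_torus g)]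
  have := norm_integral_le_of_norm_le_const (μ := torusMeasure) (f := fun t => f t - g t)
    (C := ‖f - g‖) (Filter.Eventually.of_forall fun t => (f - g).norm_coe_le_norm t)
  simpa using this

/-- Averaging over the torus is faithful. -/
theorem eq_zero_of_integral_star_mul_self {H : Type*} [NormedAddCommGroup H]
    [InnerProductSpace ℂ H] [CompleteSpace H] (f : C(Torus2, H →L[ℂ] H))
    (hf : ∫ t, (star f * f) t ∂torusMeasure = 0) : f = 0 := by
  have key : ∀ x : H, ∀ t, f t x = 0 := by
    intro x
    let g : C(Torus2, ℝ) := ⟨fun t => ‖f t x‖ ^ 2, by fun_prop⟩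
    have h1 : ∫ t, g t ∂torusMeasure = 0 := by
      have h2 : ∫ t, (inner ℂ x ((star f * f) t x) : ℂ) ∂torusMeasure = 0 := by
        have h3 := ((innerSL ℂ x).comp (ContinuousLinearMap.apply ℂ H x)).integral_comp_comm
          (integrable_torus (star f * f))
        rw [hf, map_zero] at h3
        exact h3
      have h4 : ∀ t, (inner ℂ x ((star f * f) t x) : ℂ) = ((g t : ℝ) : ℂ) := by
        intro t
        change inner ℂ x (star (f t) (f t x)) = (((‖f t x‖ ^ 2 : ℝ)) : ℂ)
        rw [ContinuousLinearMap.star_eq_adjoint, ContinuousLinearMap.adjoint_inner_right,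
          inner_self_eq_norm_sq_to_K]
        push_cast
        rfl
      simp only [h4] at h2
      rw [integral_complex_ofReal] at h2
      exact_mod_cast h2
    have h5 : ∀ t, g t = 0 := by
      by_contra! hg
      obtain ⟨t, ht⟩ := hg
      exact (g.continuous.integral_pos_of_hasCompactSupport_nonneg_nonzero
        (HasCompactSupport.of_compactSpace g) (fun t => sq_nonneg _) ht).ne' h1
    intro t
    have h6 : ‖f t x‖ ^ 2 = 0 := h5 t
    simpa using h6
  ext t x
  exact key x t

end Gauge

/-! ### C*-algebras generated by a set -/

section Generated

variable {A B : Type*} [CStarAlgebra A] [CStarAlgebra B]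

theorem cstarGen_le {S : Set A} {X : StarSubalgebra ℂ A} (hX : IsClosed (X : Set A)) (h : S ⊆ X) :
    cstarGen S ≤ X :=
  StarSubalgebra.topologicalClosure_minimal (StarAlgebra.adjoin_le h) hX

theorem cstarGen_hom_continuous {S : Set A} (φ : cstarGen S →⋆ₐ[ℂ] B) : Continuous φ :=
  AddMonoidHomClass.continuous_of_bound φ 1 fun x => by
    simpa only [one_mul] using NonUnitalStarAlgHom.norm_apply_le φ x

theorem cstarGen_hom_ext {S : Set A} {φ ψ : cstarGen S →⋆ₐ[ℂ] B}
    (h : ∀ x : cstarGen S, (x : A) ∈ S → φ x = ψ x) : φ = ψ := by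
  refine StarAlgHom.ext_topologicalClosure (cstarGen_hom_continuous φ)
    (cstarGen_hom_continuous ψ) (StarAlgHom.ext_adjoin fun x hx => ?_)
  exact h _ hx

theorem map_mem_cstarGen {S : Set A} {T : Set B} (φ : cstarGen S →⋆ₐ[ℂ] B)
    (hT : T = φ '' {x | (x : A) ∈ S}) (x : cstarGen S) : φ x ∈ cstarGen T := by
  have hc : Topology.IsClosedEmbedding (Subtype.val : cstarGen S → A) :=
    (isClosed_cstarGen S).isClosedEmbedding_subtypeVal
  have hle : cstarGen S ≤ ((cstarGen T).comap φ).map (cstarGen S).subtype := by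
    refine cstarGen_le ?_ ?_
    · exact hc.isClosedMap _ ((isClosed_cstarGen T).preimage (cstarGen_hom_continuous φ))
    · intro y hy
      refine ⟨⟨y, subset_cstarGen S hy⟩, ?_, rfl⟩
      refine subset_cstarGen T ?_
      rw [hT]
      exact ⟨_, hy, rfl⟩
  obtain ⟨y, hy, hyx⟩ := hle x.2
  rw [← Subtype.ext hyx]
  exact hy

/-- An injective `*`-homomorphism maps the C*-algebra generated by `S` onto the C*-algebra generated
by the image of `S`: being isometric, it has closed range. -/
theorem cstarGen_range_of_injective {S : Set A} {T : Set B} (φ : cstarGen S →⋆ₐ[ℂ] B)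
    (hφ : Function.Injective φ) (hT : T = φ '' {x | (x : A) ∈ S}) : φ.range = cstarGen T := by
  apply le_antisymm
  · rintro _ ⟨x, rfl⟩
    exact map_mem_cstarGen φ hT x
  · refine cstarGen_le ?_ ?_
    · have := (NonUnitalStarAlgHom.isometry φ hφ).isClosedEmbedding.isClosed_range
      exact this
    · rw [hT]
      rintro _ ⟨x, -, rfl⟩
      exact ⟨x, rfl⟩

theorem cstarGen_exists_equiv {S : Set A} {T : Set B} (φ : cstarGen S →⋆ₐ[ℂ] B)
    (hφ : Function.Injective φ) (hT : T = φ '' {x | (x : A) ∈ S}) :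
    ∃ Φ : cstarGen S ≃⋆ₐ[ℂ] cstarGen T, ∀ x, (Φ x : B) = φ x := by
  have hr := cstarGen_range_of_injective φ hφ hT
  let ψ : cstarGen S →⋆ₐ[ℂ] cstarGen T := φ.codRestrict (cstarGen T) (map_mem_cstarGen φ hT)
  refine ⟨StarAlgEquiv.ofBijective ψ ⟨fun x y h => hφ (congrArg Subtype.val h), fun y => ?_⟩,
    fun x => rfl⟩
  obtain ⟨x, hx⟩ : (y : B) ∈ φ.range := by
    rw [hr]
    exact y.2
  exact ⟨x, Subtype.ext hx⟩

end Generated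

/-! ### Comparison of an arbitrary pair with Woronowicz's pair -/

section Comparison

theorem SUq2Rel.prod {q : ℝ} {A B : Type*} [Ring A] [StarRing A] [Algebra ℂ A] [Ring B] [StarRing B]
    [Algebra ℂ B] {a c : A} {a' c' : B} (h : SUq2Rel q a c) (h' : SUq2Rel q a' c') :
    SUq2Rel q (a, a') (c, c') :=
  ⟨Prod.ext h.1 h'.1, Prod.ext h.2 h'.2, Prod.ext h.3 h'.3, Prod.ext h.4 h'.4⟩

variable {q : ℝ} {H : Type*} [NormedAddCommGroup H] [InnerProductSpace ℂ H] [CompleteSpace H]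
  {a c : H →L[ℂ] H}

open MeasureTheory

/-- On the `*`-algebra generated by the pairs `(gauge orbit of a, α)` and `(gauge orbit of c, γ)`,
the average over the torus of the first component and the diagonal of the second one are given by
the same polynomial, in `c* c` and in `γ* γ` respectively. -/
theorem exists_polynomial_average_diagonal (h : SUq2Rel q a c) (hq : |q| < 1) (hq0 : q ≠ 0)
    {x : C(Torus2, H →L[ℂ] H) × (SUq2H →L[ℂ] SUq2H)}
    (hx : x ∈ StarAlgebra.adjoin ℂ
      {(gaugeOrbit 1 0 a, bigAlpha q), (gaugeOrbit 0 1 c, bigGamma q hq)}) :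
    ∃ p : Polynomial ℂ, ∫ t, x.1 t ∂torusMeasure = Polynomial.aeval (star c * c) p ∧
      ∀ n, x.2 (SUq2H.e n 0) (n, 0) = p.eval (((q : ℂ) ^ 2) ^ n) := by
  have hx' := (h.gaugeOrbit.prod (bigAlpha_bigGamma_rel q hq)).adjoin_le_span hq0 hx
  clear hx
  have hc : ∀ j, c ^ j * star c ^ j = (star c * c) ^ j := fun j => by
    rw [(show Commute (star c) c from h.normal).mul_pow,
      ((show Commute (star c) c from h.normal).pow_pow j j).eq]
  induction hx' using Submodule.span_induction with
  | mem y hy =>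
    obtain ⟨i, j, k, rfl | rfl⟩ := hy
    · refine ⟨if i = 0 ∧ j = k then Polynomial.X ^ j else 0, ?_, fun n => ?_⟩
      · change ∫ t, (gaugeOrbit 1 0 a ^ i * (gaugeOrbit 0 1 c ^ j * star (gaugeOrbit 0 1 c) ^ k)) t
          ∂torusMeasure = _
        rw [star_gaugeOrbit, gaugeOrbit_pow, gaugeOrbit_pow, gaugeOrbit_pow, gaugeOrbit_mul,
          gaugeOrbit_mul, integral_gaugeOrbit]
        by_cases hij : i = 0 ∧ j = k
        · obtain ⟨rfl, rfl⟩ := hij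
          simp [hc]
        · rw [if_neg hij, if_neg (by omega), map_zero]
      · change (bigAlpha q ^ i * (bigGamma q hq ^ j * star (bigGamma q hq) ^ k)) _ _ = _
        rw [diagonal_word]
        split_ifs <;> simp
    · refine ⟨if i = 0 ∧ j = k then Polynomial.X ^ j else 0, ?_, fun n => ?_⟩
      · change ∫ t, (star (gaugeOrbit 1 0 a) ^ i *
          (gaugeOrbit 0 1 c ^ j * star (gaugeOrbit 0 1 c) ^ k)) t ∂torusMeasure = _
        rw [star_gaugeOrbit, star_gaugeOrbit, gaugeOrbit_pow, gaugeOrbit_pow, gaugeOrbit_pow,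
          gaugeOrbit_mul, gaugeOrbit_mul, integral_gaugeOrbit]
        by_cases hij : i = 0 ∧ j = k
        · obtain ⟨rfl, rfl⟩ := hij
          simp [hc]
        · rw [if_neg hij, if_neg (by omega), map_zero]
      · change (star (bigAlpha q) ^ i * (bigGamma q hq ^ j * star (bigGamma q hq) ^ k)) _ _ = _
        rw [diagonal_star_word]
        split_ifs <;> simp
  | zero => exact ⟨0, by simp, fun n => by simp⟩
  | add y z _ _ hy hz =>
    obtain ⟨p, hp, hp'⟩ := hy
    obtain ⟨r, hr, hr'⟩ := hz
    refine ⟨p + r, ?_, fun n => ?_⟩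
    · rw [map_add, ← hp, ← hr, ← integral_add (integrable_torus _) (integrable_torus _)]
      rfl
    · rw [Polynomial.eval_add, ← hp', ← hr']
      rfl
  | smul s y _ hy =>
    obtain ⟨p, hp, hp'⟩ := hy
    refine ⟨s • p, ?_, fun n => ?_⟩
    · rw [map_smul, ← hp, ← integral_smul]
      rfl
    · rw [Polynomial.eval_smul, ← hp']
      rfl

/-- Both sides are continuous in `x`, so that it suffices to compare a polynomial in `c* c` with its
values at the points `q^{2n}`. -/
theorem norm_integral_fst_le (h : SUq2Rel q a c) (hq : |q| < 1) (hq0 : q ≠ 0)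
    {x : C(Torus2, H →L[ℂ] H) × (SUq2H →L[ℂ] SUq2H)}
    (hx : x ∈ cstarGen {(gaugeOrbit 1 0 a, bigAlpha q), (gaugeOrbit 0 1 c, bigGamma q hq)}) :
    ‖∫ t, x.1 t ∂torusMeasure‖ ≤ ‖x.2‖ := by
  have hcl : IsClosed {x : C(Torus2, H →L[ℂ] H) × (SUq2H →L[ℂ] SUq2H) |
      ‖∫ t, x.1 t ∂torusMeasure‖ ≤ ‖x.2‖} :=
    isClosed_le (continuous_integral_torus.comp continuous_fst).norm continuous_snd.norm
  refine closure_minimal (fun y hy => ?_) hcl hx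
  obtain ⟨p, hp, hp'⟩ := exists_polynomial_average_diagonal h hq hq0 hy
  change ‖_‖ ≤ _
  rw [hp]
  refine h.norm_aeval_le hq hq0 p fun n => ?_
  rw [← hp']
  exact norm_diagonal_le _ _ _

/-- An element of the C*-algebra generated by the pairs is determined by its second component:
if `(f, 0)` lies in it, then so does `(f* f, 0)`, whence the average of `f* f` vanishes. -/
theorem eq_zero_of_snd_eq_zero (h : SUq2Rel q a c) (hq : |q| < 1) (hq0 : q ≠ 0)
    {x : C(Torus2, H →L[ℂ] H) × (SUq2H →L[ℂ] SUq2H)}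
    (hx : x ∈ cstarGen {(gaugeOrbit 1 0 a, bigAlpha q), (gaugeOrbit 0 1 c, bigGamma q hq)})
    (hx0 : x.2 = 0) : x = 0 := by
  have h1 := norm_integral_fst_le h hq hq0 (mul_mem (star_mem hx) hx)
  rw [Prod.snd_mul, hx0, mul_zero, norm_zero, norm_le_zero_iff] at h1
  exact Prod.ext (eq_zero_of_integral_star_mul_self x.1 h1) hx0

/-- Evaluation at the neutral element of the torus gives back the pair `(a, c)`, so inverting the
second projection produces the representation of `C*(α, γ)` belonging to this pair. -/
theorem SUq2Conc.exists_hom (h : SUq2Rel q a c) (hq : |q| < 1) (hq0 : q ≠ 0) :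
    ∃ ρ : SUq2Conc q hq →⋆ₐ[ℂ] (H →L[ℂ] H),
      ρ (SUq2Conc.alpha q hq) = a ∧ ρ (SUq2Conc.gamma q hq) = c := by
  let S : Set (C(Torus2, H →L[ℂ] H) × (SUq2H →L[ℂ] SUq2H)) :=
    {(gaugeOrbit 1 0 a, bigAlpha q), (gaugeOrbit 0 1 c, bigGamma q hq)}
  let φ : cstarGen S →⋆ₐ[ℂ] (SUq2H →L[ℂ] SUq2H) :=
    (StarAlgHom.snd ℂ (C(Torus2, H →L[ℂ] H)) (SUq2H →L[ℂ] SUq2H)).comp (cstarGen S).subtype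
  have hφ : Function.Injective φ := by
    rw [injective_iff_map_eq_zero]
    exact fun x hx => Subtype.ext (eq_zero_of_snd_eq_zero h hq hq0 x.2 hx)
  let A₀ : cstarGen S := ⟨(gaugeOrbit 1 0 a, bigAlpha q), subset_cstarGen _ (by simp [S])⟩
  let C₀ : cstarGen S := ⟨(gaugeOrbit 0 1 c, bigGamma q hq), subset_cstarGen _ (by simp [S])⟩
  obtain ⟨Φ, hΦ⟩ := cstarGen_exists_equiv (T := {bigAlpha q, bigGamma q hq}) φ hφ (by
    ext y
    constructor
    · rintro (rfl | rfl)
      · exact ⟨A₀, by simp [S, A₀], rfl⟩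
      · exact ⟨C₀, by simp [S, C₀], rfl⟩
    · rintro ⟨⟨x, hx'⟩, hx | hx, rfl⟩
      · exact Or.inl (congrArg Prod.snd hx)
      · exact Or.inr (congrArg Prod.snd hx))
  let ev : cstarGen S →⋆ₐ[ℂ] (H →L[ℂ] H) :=
    { toFun := fun x => x.1.1 0
      map_one' := rfl
      map_mul' := fun _ _ => rfl
      map_zero' := rfl
      map_add' := fun _ _ => rfl
      commutes' := fun _ => rfl
      map_star' := fun _ => rfl }
  have hA : Φ.symm (SUq2Conc.alpha q hq) = A₀ := by
    rw [← Φ.symm_apply_apply A₀]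
    exact congrArg _ (Subtype.ext (hΦ A₀).symm)
  have hC : Φ.symm (SUq2Conc.gamma q hq) = C₀ := by
    rw [← Φ.symm_apply_apply C₀]
    exact congrArg _ (Subtype.ext (hΦ C₀).symm)
  refine ⟨ev.comp Φ.symm.toStarAlgHom, ?_, ?_⟩
  · change ev (Φ.symm _) = a
    rw [hA]
    change gaugeOrbit 1 0 a 0 = a
    simp [gaugeOrbit_apply]
  · change ev (Φ.symm _) = c
    rw [hC]
    change gaugeOrbit 0 1 c 0 = c
    simp [gaugeOrbit_apply]

theorem SUq2Conc.hom_ext {B : Type*} [CStarAlgebra B] {hq : |q| < 1} {φ ψ : SUq2Conc q hq →⋆ₐ[ℂ] B}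
    (h1 : φ (SUq2Conc.alpha q hq) = ψ (SUq2Conc.alpha q hq))
    (h2 : φ (SUq2Conc.gamma q hq) = ψ (SUq2Conc.gamma q hq)) : φ = ψ := by
  refine cstarGen_hom_ext fun x hx => ?_
  rcases hx with hx | hx
  · rwa [show x = SUq2Conc.alpha q hq from Subtype.ext hx]
  · rwa [show x = SUq2Conc.gamma q hq from Subtype.ext hx]

end Comparison

/-! ### The universal C*-algebra -/

section Universal

instance (q : ℝ) : StarModule ℂ (SUq2Prod q) := inferInstance

instance (q : ℝ) : CStarAlgebra (SUq2Prod q) where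

theorem SUq2Univ.hom_ext {q : ℝ} {B : Type*} [CStarAlgebra B] {φ ψ : SUq2Univ q →⋆ₐ[ℂ] B}
    (h1 : φ (SUq2Univ.alpha q) = ψ (SUq2Univ.alpha q))
    (h2 : φ (SUq2Univ.gamma q) = ψ (SUq2Univ.gamma q)) : φ = ψ := by
  refine cstarGen_hom_ext fun x hx => ?_
  rcases hx with hx | hx
  · rwa [show x = SUq2Univ.alpha q from Subtype.ext hx]
  · rwa [show x = SUq2Univ.gamma q from Subtype.ext hx]

theorem SUq2Univ.rel (q : ℝ) : SUq2Rel q (SUq2Univ.alpha q) (SUq2Univ.gamma q) where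
  star_mul_add := Subtype.ext (lp.ext (funext fun ρ => ρ.rel.star_mul_add))
  mul_star_add := Subtype.ext (lp.ext (funext fun ρ => ρ.rel.mul_star_add))
  mul_comm_q := Subtype.ext (lp.ext (funext fun ρ => ρ.rel.mul_comm_q))
  normal := Subtype.ext (lp.ext (funext fun ρ => ρ.rel.normal))

/-- The representation `ρ` of the universal C*-algebra, that is, the projection onto the component
`ρ` of a family of operators. -/
def SUq2Univ.eval {q : ℝ} (ρ : SUq2Rep q) : SUq2Univ q →⋆ₐ[ℂ] (ρ.H →L[ℂ] ρ.H) where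
  toFun x := x.1 ρ
  map_one' := rfl
  map_mul' _ _ := rfl
  map_zero' := rfl
  map_add' _ _ := rfl
  commutes' _ := rfl
  map_star' _ := rfl

/-- Woronowicz's representation on `ℓ²(ℤ₊ × ℤ)`. -/
def SUq2Rep.woronowicz (q : ℝ) (hq : |q| < 1) : SUq2Rep q :=
  haveI : Nontrivial SUq2H := ⟨SUq2H.e 0 0, 0, fun h => by
    have := congrArg (fun f : SUq2H => f (0, 0)) h
    simp [SUq2H.e_apply] at this⟩
  { H := SUq2H, a := bigAlpha q, c := bigGamma q hq, rel := bigAlpha_bigGamma_rel q hq }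

end Universal

section Isomorphism

variable {q : ℝ} {hq : |q| < 1}

/-- Woronowicz's representation `π` of the universal C*-algebra. -/
def SUq2Univ.woronowicz (q : ℝ) (hq : |q| < 1) : SUq2Univ q →⋆ₐ[ℂ] (SUq2H →L[ℂ] SUq2H) :=
  SUq2Univ.eval (SUq2Rep.woronowicz q hq)

theorem SUq2Univ.woronowicz_image (q : ℝ) (hq : |q| < 1) :
    {bigAlpha q, bigGamma q hq} = SUq2Univ.woronowicz q hq ''
      {x | (x : SUq2Prod q) ∈ ({SUq2Prod.alpha q, SUq2Prod.gamma q} : Set (SUq2Prod q))} := by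
  ext y
  constructor
  · rintro (rfl | rfl)
    · exact ⟨SUq2Univ.alpha q, Or.inl rfl, rfl⟩
    · exact ⟨SUq2Univ.gamma q, Or.inr rfl, rfl⟩
  · rintro ⟨x, hx | hx, rfl⟩
    · exact Or.inl (congrArg (fun z : SUq2Prod q => z (SUq2Rep.woronowicz q hq)) hx)
    · exact Or.inr (congrArg (fun z : SUq2Prod q => z (SUq2Rep.woronowicz q hq)) hx)

/-- Every pair satisfying the relations gives a representation of the universal C*-algebra that
factors through `π`. -/
theorem SUq2Univ.exists_factor (hq : |q| < 1) (hq0 : q ≠ 0) {H : Type*} [NormedAddCommGroup H]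
    [InnerProductSpace ℂ H] [CompleteSpace H] {a c : H →L[ℂ] H} (h : SUq2Rel q a c) :
    ∃ ψ : SUq2Univ q →⋆ₐ[ℂ] (H →L[ℂ] H), ψ (SUq2Univ.alpha q) = a ∧ ψ (SUq2Univ.gamma q) = c ∧
      ∀ x, SUq2Univ.woronowicz q hq x = 0 → ψ x = 0 := by
  obtain ⟨ρ, hρa, hρc⟩ := SUq2Conc.exists_hom h hq hq0
  let π : SUq2Univ q →⋆ₐ[ℂ] SUq2Conc q hq := (SUq2Univ.woronowicz q hq).codRestrict (SUq2Conc q hq)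
    (map_mem_cstarGen _ (SUq2Univ.woronowicz_image q hq))
  refine ⟨ρ.comp π, hρa, hρc, fun x hx => ?_⟩
  have : π x = 0 := Subtype.ext hx
  change ρ (π x) = 0
  rw [this, map_zero]

theorem SUq2Univ.woronowicz_injective (q : ℝ) (hq : |q| < 1) (hq0 : q ≠ 0) :
    Function.Injective (SUq2Univ.woronowicz q hq) := by
  rw [injective_iff_map_eq_zero]
  intro x hx
  refine Subtype.ext (lp.ext (funext fun ρ => ?_))
  obtain ⟨ψ, ha, hc, hψ⟩ := SUq2Univ.exists_factor hq hq0 ρ.rel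
  have h : ψ = SUq2Univ.eval ρ := SUq2Univ.hom_ext ha hc
  have h' := hψ x hx
  rw [h] at h'
  exact h'

end Isomorphism

end

theorem theorem2p1 (q : ℝ) (hq : |q| < 1) (hq0 : q ≠ 0) :
    -- every pair of operators satisfying the relations comes from a unique representation
    -- of `C*(α, γ)`
    (∀ (H₀ : Type*) [NormedAddCommGroup H₀] [InnerProductSpace ℂ H₀] [CompleteSpace H₀]
      (α₀ γ₀ : H₀ →L[ℂ] H₀), SUq2Rel q α₀ γ₀ →
      ∃! ρ : SUq2Conc q hq →⋆ₐ[ℂ] (H₀ →L[ℂ] H₀),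
        ρ (SUq2Conc.alpha q hq) = α₀ ∧ ρ (SUq2Conc.gamma q hq) = γ₀) ∧
    -- the universal C*-algebra has the universal property
    (SUq2Rel q (SUq2Univ.alpha q) (SUq2Univ.gamma q) ∧
      ∀ (H₀ : Type*) [NormedAddCommGroup H₀] [InnerProductSpace ℂ H₀] [CompleteSpace H₀]
        (α₀ γ₀ : H₀ →L[ℂ] H₀), SUq2Rel q α₀ γ₀ →
        ∃! ρ : SUq2Univ q →⋆ₐ[ℂ] (H₀ →L[ℂ] H₀),
          ρ (SUq2Univ.alpha q) = α₀ ∧ ρ (SUq2Univ.gamma q) = γ₀) ∧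
    -- Woronowicz's representation `π` exists, is unique, and is faithful with image `C*(α, γ)`
    (∃ π : SUq2Univ q →⋆ₐ[ℂ] (SUq2H →L[ℂ] SUq2H),
      (π (SUq2Univ.alpha q) = bigAlpha q ∧ π (SUq2Univ.gamma q) = bigGamma q hq) ∧
      (∀ π' : SUq2Univ q →⋆ₐ[ℂ] (SUq2H →L[ℂ] SUq2H),
        π' (SUq2Univ.alpha q) = bigAlpha q ∧ π' (SUq2Univ.gamma q) = bigGamma q hq → π' = π) ∧
      Function.Injective π ∧
      π.range = SUq2Conc q hq) ∧
    -- the universal C*-algebra is isomorphic to `C*(α, γ)`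
    (∃ Φ : SUq2Univ q ≃⋆ₐ[ℂ] SUq2Conc q hq,
      Φ (SUq2Univ.alpha q) = SUq2Conc.alpha q hq ∧
      Φ (SUq2Univ.gamma q) = SUq2Conc.gamma q hq) := by
  refine ⟨fun H₀ _ _ _ α₀ γ₀ h => ?_, ⟨SUq2Univ.rel q, fun H₀ _ _ _ α₀ γ₀ h => ?_⟩,
    ⟨SUq2Univ.woronowicz q hq, ⟨rfl, rfl⟩, fun π' h => SUq2Univ.hom_ext h.1 h.2,
      SUq2Univ.woronowicz_injective q hq hq0, ?_⟩, ?_⟩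
  · obtain ⟨ρ, h1, h2⟩ := SUq2Conc.exists_hom h hq hq0
    exact ⟨ρ, ⟨h1, h2⟩, fun ρ' h' => SUq2Conc.hom_ext (h'.1.trans h1.symm) (h'.2.trans h2.symm)⟩
  · obtain ⟨ρ, h1, h2, -⟩ := SUq2Univ.exists_factor hq hq0 h
    exact ⟨ρ, ⟨h1, h2⟩, fun ρ' h' => SUq2Univ.hom_ext (h'.1.trans h1.symm) (h'.2.trans h2.symm)⟩
  · exact cstarGen_range_of_injective _ (SUq2Univ.woronowicz_injective q hq hq0)
      (SUq2Univ.woronowicz_image q hq)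
  · obtain ⟨Φ, hΦ⟩ := cstarGen_exists_equiv _ (SUq2Univ.woronowicz_injective q hq hq0)
      (SUq2Univ.woronowicz_image q hq)
    exact ⟨Φ, Subtype.ext (hΦ _), Subtype.ext (hΦ _)⟩
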